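/- A \emph{finite space} is a finite connected (in particular non-empty) $T_0$ topological space $P$, identified with a finite poset whose open sets are the down-sets; $P^n$ carries the product order and the product topology. For $n\ge 2$ and $m\ge 1$ let $J_{n,m}$ be the poset with points $0$ and $k_j$ ($1\le k\le m$, $1\le j\le n$) formed by the $n$ fences $0\le 1_j\ge 2_j\le\cdots m_j$ glued at $0$. Let $P^{J_{n,m}}$ be the set of order-preserving maps $J_{n,m}\to P$ with the pointwise order, and let $q_{n,m}:P^{J_{n,m}}\to P^n$ be $q_{n,m}(\gamma)=(\gamma(m_1),\dots,\gamma(m_n))$. Let $CC_{n,m}(P)$ be the least positive integer $r$ (or $\infty$) such that $P^n$ is covered by $r$ open sets on each of which $q_{n,m}$ has an order-preserving section, and let $CC_n(P)=\min_{m\ge 1}CC_{n,m}(P)$. For a path-connected space $X$ and a base point $x_0\in X$, let $cat(X)$ be the least number $r$ (or $\infty$) such that $X$ is covered by $r$ open sets on each of which the map $\gamma\mapsto\gamma(1)$, from the space of paths $[0,1]\to X$ starting at $x_0$ (with the compact-open topology) to $X$, has a continuous section. Let $P$ be a finite space and $n\ge 2$. Then: (a) $CC_n(P)\le CC_{n+1}(P)$.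 (b) $P$ is contractible if and only if $CC_n(P)=1$. (c) If $Q$ is a finite space homotopy equivalent to $P$, then $CC_n(P)=CC_n(Q)$. (d) $cat(P)\le CC_n(P)\le cat(P^n)\le cat(P)^n$, for any choice of base points in $P$ and in $P^n$. Here (b) and (c) hold both for the usual topological notion of homotopy and for the combinatorial one, in which $f,g:P\to Q$ are homotopic if there are $m\ge 0$ and an order-preserving map $H:P\times J_m\to Q$ with $H(x,0)=f(x)$ and $H(x,m)=g(x)$, where $J_m$ is the fence $0\le 1\ge 2\le\cdots m$. -/

import Mathlib

/-- The finite fence `J_m`: the points `0, 1, …, m` with the zigzag order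
`0 ≤ 1 ≥ 2 ≤ ⋯ m`. -/
@[ext]
structure Fence (m : ℕ) where
  pos : Fin (m + 1)

namespace Fence

/-- The only strict relations are `i < j` with `i` even, `j` odd and `|i - j| = 1`. -/
instance (m : ℕ) : PartialOrder (Fence m) where
  le x y := x = y ∨ (Even x.pos.val ∧ Odd y.pos.val ∧
    (x.pos.val = y.pos.val + 1 ∨ y.pos.val = x.pos.val + 1))
  le_refl x := Or.inl rfl
  le_trans := by
    rintro x y z (rfl | ⟨hx, hy, hxy⟩) (rfl | ⟨hy', hz, hyz⟩)
    · exact Or.inl rfl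
    · exact Or.inr ⟨hy', hz, hyz⟩
    · exact Or.inr ⟨hx, hy, hxy⟩
    · exact absurd hy' (Nat.not_even_iff_odd.2 hy)
  le_antisymm := by
    rintro x y (rfl | ⟨hx, hy, hxy⟩) (h | ⟨hy', hz, hyz⟩)
    · rfl
    · rfl
    · exact h.symm
    · exact absurd hy' (Nat.not_even_iff_odd.2 hy)

/-- The starting point `0` of the fence `J_m`. -/
def first (m : ℕ) : Fence m := ⟨0⟩

/-- The end point `m` of the fence `J_m`. -/
def last (m : ℕ) : Fence m := ⟨Fin.last m⟩

end Fence

/-- The underlying set of `J_{n,m}`: a base point `0` and the points `k_j` for `1 ≤ k ≤ m` and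
`n` values of `j`. Here `node k j`, with `k : Fin m` counted from zero, is the point `(k+1)_j`. -/
inductive FenceWedge (n m : ℕ) : Type
  | base : FenceWedge n m
  | node (k : Fin m) (j : Fin n) : FenceWedge n m

namespace FenceWedge

variable {n m : ℕ}

/-- The position of a point along its fence: `0` for the base point and `k` for `k_j`. -/
def height : FenceWedge n m → ℕ
  | base => 0
  | node k _ => k.val + 1

/-- Two points lie on a common fence. -/
def SameBranch : FenceWedge n m → FenceWedge n m → Prop
  | node _ i, node _ j => i = j
  | _, _ => True

/-- `J_{n,m}` consists of `n` fences `0 ≤ 1_j ≥ 2_j ≤ ⋯ m_j` with common point `0`: the only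
strict relations are between neighbours on a common fence, from even to odd position. -/
instance : PartialOrder (FenceWedge n m) where
  le x y := x = y ∨ (Even x.height ∧ Odd y.height ∧
    (x.height = y.height + 1 ∨ y.height = x.height + 1) ∧ SameBranch x y)
  le_refl x := Or.inl rfl
  le_trans := by
    rintro x y z (rfl | ⟨hx, hy, hxy⟩) (rfl | ⟨hy', hz, hyz⟩)
    · exact Or.inl rfl
    · exact Or.inr ⟨hy', hz, hyz⟩
    · exact Or.inr ⟨hx, hy, hxy⟩
    · exact absurd hy' (Nat.not_even_iff_odd.2 hy)
  le_antisymm := by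
    rintro x y (rfl | ⟨hx, hy, hxy⟩) (h | ⟨hy', hz, hyz⟩)
    · rfl
    · rfl
    · exact h.symm
    · exact absurd hy' (Nat.not_even_iff_odd.2 hy)

end FenceWedge

/-- The end point `m_j` of the `j`-th fence of `J_{n,m}` (the base point when `m = 0`). -/
def FenceWedge.tip {n : ℕ} : (m : ℕ) → Fin n → FenceWedge n m
  | 0, _ => FenceWedge.base
  | m + 1, j => FenceWedge.node (Fin.last m) j

/-- The canonical projection `q_{n,m} : P^{J_{n,m}} → P^n`, `γ ↦ (γ(m_1), …, γ(m_n))`. -/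
def wedgeEval (n m : ℕ) (P : Type*) [PartialOrder P] (γ : FenceWedge n m →o P) : Fin n → P :=
  fun j => γ (FenceWedge.tip m j)

/-- `CC_{n,m}(P)`: the smallest positive integer `r` such that `P^n` is covered by `r` open sets
on each of which `q_{n,m}` has an order-preserving section (`⊤` if there is none). -/
noncomputable def higherCombComplexityAt (n m : ℕ) (P : Type*) [PartialOrder P]
    [TopologicalSpace P] : ℕ∞ :=
  ⨅ (r : ℕ) (_ : 1 ≤ r ∧ ∃ U : Fin r → Set (Fin n → P),
      (∀ i, IsOpen (U i)) ∧ (⋃ i, U i) = Set.univ ∧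
      ∀ i, ∃ s : U i →o (FenceWedge n m →o P), ∀ p : U i, wedgeEval n m P (s p) = p),
    (r : ℕ∞)

/-- The higher combinatorial complexity `CC_n(P) = min_{m ≥ 1} CC_{n,m}(P)`. -/
noncomputable def higherCombComplexity (n : ℕ) (P : Type*) [PartialOrder P]
    [TopologicalSpace P] : ℕ∞ :=
  ⨅ (m : ℕ) (_ : 1 ≤ m), higherCombComplexityAt n m P

/-- The Schwarz genus of `p : E → B`: the minimal number of open sets covering `B` on each of
which `p` has a continuous section (`⊤` if there is none). -/
noncomputable def schwarzGenus {E B : Type*} [TopologicalSpace E] [TopologicalSpace B]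
    (p : E → B) : ℕ∞ :=
  ⨅ (r : ℕ) (_ : ∃ U : Fin r → Set B, (∀ i, IsOpen (U i)) ∧ (⋃ i, U i) = Set.univ ∧
      ∀ i, ∃ s : C(U i, E), ∀ b : U i, p (s b) = b),
    (r : ℕ∞)

/-- The space of paths in `X` starting at `x₀`, with the compact-open topology. -/
abbrev BasedPathSpace (X : Type*) [TopologicalSpace X] (x₀ : X) : Type _ :=
  {γ : C(unitInterval, X) // γ 0 = x₀}

/-- The Lusternik–Schnirelmann category of `X` (normalised so that contractible spaces have
category `1`): the Schwarz genus of `γ ↦ γ(1)` on the space of paths starting at `x₀`. -/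
noncomputable def lsCat (X : Type*) [TopologicalSpace X] (x₀ : X) : ℕ∞ :=
  schwarzGenus (fun γ : BasedPathSpace X x₀ => γ.1 1)

/-- Homotopy of order-preserving maps along a finite fence. -/
def FenceHomotopic {P Q : Type*} [PartialOrder P] [PartialOrder Q] (f g : P →o Q) : Prop :=
  ∃ (m : ℕ) (H : P × Fence m →o Q),
    ∀ x, H (x, Fence.first m) = f x ∧ H (x, Fence.last m) = g x

/-- The identity of `P` is fence-homotopic to a constant map. -/
def FenceContractible (P : Type*) [PartialOrder P] : Prop :=
  ∃ x₀ : P, FenceHomotopic (OrderHom.id : P →o P) (OrderHom.const P x₀)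

/-- Homotopy equivalence of posets with respect to fence homotopies. -/
def FenceHomotopyEquivalent (P Q : Type*) [PartialOrder P] [PartialOrder Q] : Prop :=
  ∃ (f : P →o Q) (g : Q →o P),
    FenceHomotopic (g.comp f) OrderHom.id ∧ FenceHomotopic (f.comp g) OrderHom.id

/-! By transposition, a monotone section of `q_{n,m}` over `U` is a monotone map from `J_{n,m}` to
the poset of monotone maps `U → P` sending the tips to the coordinate projections. Since zigzags can
be padded with constants, some `m` works for all members of a finite cover exactly when, on each
member, all projections lie in the component of one map. So `CC_n(P)` is the least size of a cover
as in `HasLinkedCover`.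

Being linked is fence homotopy, and on finite posets also topological homotopy: minimal open
neighbourhoods together with connectedness of the interval turn a homotopy into a chain of
comparisons. Hence `cat` counts open sets whose inclusion is linked to a constant
(`exists_path_section_iff`).

The claims then become manipulations of covers. Pulling back along monotone maps gives (a) and (c).
Restricting two projections to a coordinate line makes one the inclusion and the other constant,
which gives the nontrivial direction of (b) and the first bound in (d). Composing with projections
and taking products of covers give the other two bounds. -/

/-- Two elements of a preorder are joined by a finite chain of comparisons. -/
abbrev OrderLinked {A : Type*} [Preorder A] (a b : A) : Prop :=
  Relation.EqvGen (· ≤ ·) a b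

namespace OrderLinked

variable {A B : Type*} [Preorder A] [Preorder B]

theorem of_le {a b : A} (h : a ≤ b) : OrderLinked a b := .rel _ _ h

theorem trans {a b c : A} (h : OrderLinked a b) (h' : OrderLinked b c) : OrderLinked a c :=
  Relation.EqvGen.trans _ _ _ h h'

theorem map {F : A → B} (hF : Monotone F) {a b : A} (h : OrderLinked a b) :
    OrderLinked (F a) (F b) := by
  induction h with
  | rel _ _ h => exact .rel _ _ (hF h)
  | refl => exact .refl _
  | symm _ _ _ ih => exact .symm _ _ ih
  | trans _ _ _ _ _ ih₁ ih₂ => exact .trans ih₁ ih₂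

/-- Precomposition with a monotone map preserves linked maps. -/
theorem comp_right {C : Type*} [Preorder C] {f g : B →o C} (h : OrderLinked f g) (k : A →o B) :
    OrderLinked (f.comp k) (g.comp k) :=
  h.map (F := fun f : B →o C => f.comp k) fun _ _ hab x => OrderHom.le_def.1 hab (k x)

/-- Postcomposition with a monotone map preserves linked maps. -/
theorem comp_left {C : Type*} [Preorder C] {f g : A →o B} (h : OrderLinked f g) (k : B →o C) :
    OrderLinked (k.comp f) (k.comp g) :=
  h.map (F := fun f : A →o B => k.comp f) fun _ _ hab x => k.monotone (OrderHom.le_def.1 hab x)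

/-- Linked elements give linked constant maps. -/
theorem const {a b : B} (h : OrderLinked a b) :
    OrderLinked (OrderHom.const A a) (OrderHom.const A b) :=
  h.map (F := fun a => OrderHom.const A a) fun _ _ hab _ => hab

end OrderLinked

/-! ### Zigzags and fence homotopies -/

/-- An infinite sequence `h 0 ≤ h 1 ≥ h 2 ≤ ⋯`. -/
def IsZigzag {A : Type*} [Preorder A] (h : ℕ → A) : Prop :=
  (∀ k, Even k → h k ≤ h (k + 1)) ∧ ∀ k, Odd k → h (k + 1) ≤ h k

theorem IsZigzag.le {A : Type*} [Preorder A] {h : ℕ → A} (hh : IsZigzag h) {i j : ℕ}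
    (hi : Even i) (hj : Odd j) (hij : i = j + 1 ∨ j = i + 1) : h i ≤ h j := by
  rcases hij with rfl | rfl
  · exact hh.2 _ hj
  · exact hh.1 _ hi

/-- Replace the values of an eventually constant zigzag from position `N` on. -/
theorem IsZigzag.extend {A : Type*} [Preorder A] {h : ℕ → A} (hh : IsZigzag h) {M N : ℕ} {b c : A}
    (hM : ∀ k ≥ M, h k = b) (hN : M + 1 ≤ N) (hbc : Odd N ∧ b ≤ c ∨ Even N ∧ c ≤ b) :
    IsZigzag fun k => if k < N then h k else c := by
  constructor
  all_goals
    intro k hk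
    dsimp only
    rcases lt_trichotomy (k + 1) N with hlt | heq | hgt
    · rw [if_pos hlt, if_pos (by omega)]
      first | exact hh.1 k hk | exact hh.2 k hk
    · rw [if_neg (show ¬k + 1 < N by omega), if_pos (by omega), hM k (by omega)]
      subst heq
      rcases hbc with ⟨h1, h2⟩ | ⟨h1, h2⟩
      all_goals
        first
          | exact h2
          | exact absurd h1 (by simpa [Nat.even_add_one, Nat.odd_add_one] using hk)
    · rw [if_neg (by omega), if_neg (by omega)]

/-- Eventually constant infinite sequences allow several links to be run to a common length. -/
theorem OrderLinked.exists_zigzag {A : Type*} [Preorder A] {a b : A} (hab : OrderLinked a b) :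
    ∃ h : ℕ → A, IsZigzag h ∧ h 0 = a ∧ ∃ M, ∀ k ≥ M, h k = b := by
  unfold OrderLinked at hab
  rw [← Relation.EqvGen.reflTransGen_symmGen] at hab
  induction hab with
  | refl => exact ⟨fun _ => a, ⟨fun _ _ => le_rfl, fun _ _ => le_rfl⟩, rfl, 0, fun _ _ => rfl⟩
  | @tail b c _ hbc ih =>
    obtain ⟨h, hh, h0, M, hM⟩ := ih
    obtain ⟨N, hN, hN'⟩ : ∃ N, M + 1 ≤ N ∧ (Odd N ∧ b ≤ c ∨ Even N ∧ c ≤ b) := by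
      rcases hbc with hle | hle
      · exact ⟨2 * M + 1, by omega, .inl ⟨⟨M, rfl⟩, hle⟩⟩
      · exact ⟨2 * M + 2, by omega, .inr ⟨⟨M + 1, by ring⟩, hle⟩⟩
    refine ⟨_, hh.extend hM hN hN', ?_, N, fun k hk => if_neg (by omega)⟩
    rw [if_pos (by omega), h0]

/-- The points of a fence map to linked elements. -/
theorem Fence.orderLinked_last {A : Type*} [Preorder A] {m : ℕ} (φ : Fence m →o A) :
    OrderLinked (φ (Fence.first m)) (φ (Fence.last m)) := by
  have key : ∀ k (hk : k < m + 1), OrderLinked (φ (Fence.first m)) (φ ⟨⟨k, hk⟩⟩) := by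
    intro k
    induction k with
    | zero => exact fun _ => .refl _
    | succ k ih =>
      intro hk
      refine .trans (ih (by omega)) ?_
      rcases Nat.even_or_odd k with he | ho
      · exact OrderLinked.of_le (φ.monotone (Or.inr ⟨he, he.add_one, Or.inr rfl⟩))
      · exact .symm _ _ (OrderLinked.of_le (φ.monotone (Or.inr ⟨ho.add_one, ho, Or.inl rfl⟩)))
  exact key m (by omega)

theorem fenceHomotopic_iff_orderLinked {P Q : Type*} [PartialOrder P] [PartialOrder Q]
    {f g : P →o Q} : FenceHomotopic f g ↔ OrderLinked f g := by
  constructor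
  · rintro ⟨m, H, hH⟩
    let φ : Fence m →o (P →o Q) :=
      ⟨fun i => ⟨fun x => H (x, i), fun x y hxy => H.monotone ⟨hxy, le_rfl⟩⟩,
        fun i j hij x => H.monotone ⟨le_rfl, hij⟩⟩
    have h0 : φ (Fence.first m) = f := by ext x; exact (hH x).1
    have h1 : φ (Fence.last m) = g := by ext x; exact (hH x).2
    rw [← h0, ← h1]
    exact Fence.orderLinked_last φ
  · intro h
    obtain ⟨h, hh, h0, M, hM⟩ := h.exists_zigzag
    refine ⟨M, ⟨fun x => h x.2.pos.val x.1, ?_⟩, fun x => ⟨?_, ?_⟩⟩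
    · rintro ⟨x, i⟩ ⟨y, j⟩ ⟨hxy, hij⟩
      refine ((h i.pos.val).monotone hxy).trans ?_
      rcases hij with hij | ⟨hi, hj, hij⟩
      · dsimp only at hij
        rw [hij]
      · exact hh.le hi hj hij y
    · exact congrArg (fun k : P →o Q => k x) h0
    · exact congrArg (fun k : P →o Q => k x) (hM M le_rfl)

/-! ### Sections of `q_{n,m}` as links between projections -/

/-- The inclusion of the `j`-th fence into `J_{n,m}`. -/
def FenceWedge.branch {n m : ℕ} (j : Fin n) : Fence m →o FenceWedge n m where
  toFun x := Fin.cases FenceWedge.base (fun k => FenceWedge.node k j) x.pos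
  monotone' := by
    rintro ⟨x⟩ ⟨y⟩ (h | ⟨hx, hy, hxy⟩)
    · rw [h]
    · refine Or.inr ?_
      induction x using Fin.cases <;> induction y using Fin.cases <;>
        first
          | exact ⟨hx, hy, hxy, trivial⟩
          | exact ⟨hx, hy, hxy, rfl⟩

theorem FenceWedge.branch_last {n m : ℕ} (j : Fin n) :
    FenceWedge.branch j (Fence.last m) = FenceWedge.tip m j := by
  cases m <;> rfl

/-- The `j`-th projection `P^n → P`, restricted to a subset. -/
def coordHom {P : Type*} [Preorder P] {n : ℕ} (U : Set (Fin n → P)) (j : Fin n) : U →o P :=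
  ⟨fun x => x.1 j, fun _ _ h => h j⟩

theorem orderLinked_coordHom_of_section {P : Type*} [PartialOrder P] {n m : ℕ}
    {U : Set (Fin n → P)} (s : U →o (FenceWedge n m →o P))
    (hs : ∀ p : U, wedgeEval n m P (s p) = p) :
    ∃ g : U →o P, ∀ j, OrderLinked g (coordHom U j) := by
  let φ : FenceWedge n m →o (U →o P) :=
    ⟨fun w => ⟨fun x => s x w, fun x y hxy => s.monotone hxy w⟩,
      fun v w hvw x => (s x).monotone hvw⟩
  refine ⟨φ .base, fun j => ?_⟩
  have h := Fence.orderLinked_last (φ.comp (FenceWedge.branch j))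
  have h1 : φ (FenceWedge.branch j (Fence.last m)) = coordHom U j := by
    rw [FenceWedge.branch_last]
    ext x
    exact congrFun (hs x) j
  rw [← h1]
  exact h

theorem exists_section_of_orderLinked {P : Type*} [PartialOrder P] {n : ℕ}
    {U : Set (Fin n → P)} {g : U →o P} (hg : ∀ j, OrderLinked g (coordHom U j)) :
    ∃ M, ∀ m ≥ M, ∃ s : U →o (FenceWedge n m →o P), ∀ p : U, wedgeEval n m P (s p) = p := by
  choose h hh h0 M hM using fun j => (hg j).exists_zigzag
  -- The extra `1` makes `m` positive, so that each tip is a node rather than the base point.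
  refine ⟨(Finset.univ.sup M) + 1, fun m hm => ?_⟩
  let φ : FenceWedge n m → (U →o P)
    | .base => g
    | .node k j => h j (k.val + 1)
  have hφ : Monotone φ := by
    rintro v w (rfl | ⟨hv, hw, hvw, hb⟩)
    · exact le_rfl
    · rcases v with _ | ⟨k, i⟩ <;> rcases w with _ | ⟨l, j⟩
      · exact le_rfl
      · have := (hh j).le hv hw hvw
        simpa only [FenceWedge.height, h0] using this
      · exact absurd hw (by simp [FenceWedge.height])
      · obtain rfl : i = j := hb
        exact (hh i).le hv hw hvw
  refine ⟨⟨fun x => ⟨fun w => φ w x, fun v w hvw => hφ hvw x⟩,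
    fun x y hxy w => (φ w).monotone hxy⟩, fun p => ?_⟩
  obtain ⟨m, rfl⟩ : ∃ k, m = k + 1 := ⟨m - 1, by omega⟩
  ext j
  have hj : M j ≤ Finset.univ.sup M := Finset.le_sup (Finset.mem_univ j)
  exact congrArg (fun k : U →o P => k p) (hM j (m + 1) (by omega))

/-- `P^n` is covered by `r` open sets on each of which all projections to `P` are linked. -/
def HasLinkedCover (n : ℕ) (P : Type*) [PartialOrder P] [TopologicalSpace P] (r : ℕ) : Prop :=
  ∃ U : Fin r → Set (Fin n → P), (∀ i, IsOpen (U i)) ∧ (⋃ i, U i) = Set.univ ∧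
    ∀ i, ∃ g : U i →o P, ∀ j, OrderLinked g (coordHom (U i) j)

theorem HasLinkedCover.one_le {n : ℕ} {P : Type*} [PartialOrder P] [TopologicalSpace P]
    [Nonempty P] {r : ℕ} (h : HasLinkedCover n P r) : 1 ≤ r := by
  obtain ⟨U, -, hU, -⟩ := h
  obtain ⟨x⟩ := ‹Nonempty P›
  have hx : (fun _ => x : Fin n → P) ∈ ⋃ i, U i := hU ▸ Set.mem_univ _
  obtain ⟨i, -⟩ := Set.mem_iUnion.1 hx
  exact Nat.one_le_iff_ne_zero.2 fun h => (h ▸ i).elim0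

theorem higherCombComplexity_le {n : ℕ} {P : Type*} [PartialOrder P] [TopologicalSpace P]
    [Nonempty P] {r : ℕ} (h : HasLinkedCover n P r) : higherCombComplexity n P ≤ r := by
  have hr := h.one_le
  obtain ⟨U, hUo, hU, hg⟩ := h
  choose g hg using hg
  choose M hM using fun i => exists_section_of_orderLinked (hg i)
  refine (iInf₂_le (Finset.univ.sup M + 1) (by omega)).trans
    (iInf₂_le r ⟨hr, U, hUo, hU, fun i => hM i _ ?_⟩)
  exact (Finset.le_sup (Finset.mem_univ i)).trans (Nat.le_succ _)

theorem le_higherCombComplexity {n : ℕ} {P : Type*} [PartialOrder P] [TopologicalSpace P]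
    {c : ℕ∞} (h : ∀ r : ℕ, 1 ≤ r → HasLinkedCover n P r → c ≤ r) :
    c ≤ higherCombComplexity n P := by
  refine le_iInf₂ fun m _ => le_iInf₂ fun r ⟨hr, U, hUo, hU, hs⟩ =>
    h r hr ⟨U, hUo, hU, fun i => ?_⟩
  obtain ⟨s, hs⟩ := hs i
  exact orderLinked_coordHom_of_section s hs

theorem higherCombComplexity_eq_one_iff {n : ℕ} {P : Type*} [PartialOrder P] [TopologicalSpace P]
    [Nonempty P] : higherCombComplexity n P = 1 ↔ HasLinkedCover n P 1 := by
  constructor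
  · intro h
    by_contra hn
    have : (2 : ℕ∞) ≤ higherCombComplexity n P := le_higherCombComplexity fun r hr hc => by
      have : r ≠ 1 := fun h => hn (h ▸ hc)
      exact_mod_cast (by omega : 2 ≤ r)
    rw [h] at this
    exact absurd this (by decide)
  · intro h
    refine le_antisymm (by exact_mod_cast higherCombComplexity_le h)
      (le_higherCombComplexity fun r hr _ => by exact_mod_cast hr)

/-- Transport of covers along continuous monotone maps `Q^k → P^n`. -/
theorem HasLinkedCover.transport {n k : ℕ} {P Q : Type*} [PartialOrder P] [TopologicalSpace P]
    [PartialOrder Q] [TopologicalSpace Q] {r : ℕ} (h : HasLinkedCover n P r)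
    (φ : (Fin k → Q) →o (Fin n → P)) (hφ : Continuous φ) (f : P →o Q) (σ : Fin k → Fin n)
    (hf : ∀ j, OrderLinked
      (f.comp ((⟨fun y => φ y (σ j), fun _ _ hxy => φ.monotone hxy (σ j)⟩ : (Fin k → Q) →o P)))
      ⟨fun y => y j, fun _ _ hxy => hxy j⟩) : HasLinkedCover k Q r := by
  obtain ⟨U, hUo, hU, hg⟩ := h
  refine ⟨fun i => φ ⁻¹' U i, fun i => (hUo i).preimage hφ, by
    rw [← Set.preimage_iUnion, hU, Set.preimage_univ], fun i => ?_⟩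
  obtain ⟨g, hg⟩ := hg i
  let ψ : (φ ⁻¹' U i : Set (Fin k → Q)) →o U i :=
    ⟨fun y => ⟨φ y.1, y.2⟩, fun _ _ hxy => φ.monotone hxy⟩
  -- On each pullback, `f` after the `σ j`-th coordinate of `φ` agrees up to links with the `j`-th
  -- projection.
  refine ⟨f.comp (g.comp ψ), fun j => .trans (((hg (σ j)).comp_right ψ).comp_left f) ?_⟩
  exact (hf j).comp_right ⟨Subtype.val, fun _ _ hxy => hxy⟩

/-! ### Homotopy and category for the lower set topology -/

section Topology

open Topology unitInterval

variable {X Y : Type*} [PartialOrder X] [TopologicalSpace X] [PartialOrder Y] [TopologicalSpace Y]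

/-- An Alexandrov-discrete topology is determined by its specialization preorder; this equips finite
powers and subspaces. -/
theorem isLowerSet_of_specializes [AlexandrovDiscrete X] (h : ∀ x y : X, x ⤳ y ↔ x ≤ y) :
    Topology.IsLowerSet X where
  topology_eq_lowerSetTopology := by
    refine TopologicalSpace.ext_iff.2 fun s => ?_
    rw [isOpen_iff_forall_specializes]
    change _ ↔ IsLowerSet s
    simp only [h]
    exact ⟨fun hs a b hba ha => hs b a hba ha, fun hs x y hxy hy => hs hxy hy⟩

instance Topology.IsLowerSet.pi {ι : Type*} [Finite ι] [Topology.IsLowerSet X] :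
    Topology.IsLowerSet (ι → X) :=
  isLowerSet_of_specializes fun x y => by
    simp only [specializes_pi, Topology.IsLowerSet.specializes_iff_le, Pi.le_def]

instance Topology.IsLowerSet.subtype [Topology.IsLowerSet X] {p : X → Prop} :
    Topology.IsLowerSet (Subtype p) :=
  isLowerSet_of_specializes fun x y => by
    rw [subtype_specializes_iff, Topology.IsLowerSet.specializes_iff_le, Subtype.coe_le_coe]

variable [Topology.IsLowerSet X] [Topology.IsLowerSet Y]

theorem OrderHom.continuous_of_isLowerSet (f : X →o Y) : Continuous f :=
  Topology.IsLowerSet.monotone_iff_continuous.1 f.monotone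

/-- A monotone map between spaces with the lower set topology, as a continuous map. -/
def OrderHom.toLowerContinuousMap (f : X →o Y) : C(X, Y) := ⟨f, f.continuous_of_isLowerSet⟩

/-- A continuous map between spaces with the lower set topology, as a monotone map. -/
def ContinuousMap.toLowerOrderHom (f : C(X, Y)) : X →o Y :=
  ⟨f, Topology.IsLowerSet.monotone_iff_continuous.2 f.continuous⟩

/-- The homotopy is `g` at time `0` and jumps to `f` at once; this is continuous because open sets
are down-sets and `f ≤ g`. -/
theorem homotopic_of_le {f g : X →o Y} (h : f ≤ g) :
    ContinuousMap.Homotopic g.toLowerContinuousMap f.toLowerContinuousMap := by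
  classical
  refine ⟨⟨⟨fun p : I × X => if p.1 = 0 then g p.2 else f p.2, ?_⟩, fun x => ?_, fun x => ?_⟩⟩
  · refine continuous_def.2 fun V hV => ?_
    have hlow := Topology.IsLowerSet.isOpen_iff_isLowerSet.1 hV
    have heq : (fun p : I × X => if p.1 = 0 then g p.2 else f p.2) ⁻¹' V =
        (Set.univ ×ˢ (g ⁻¹' V)) ∪ ({0}ᶜ ×ˢ (f ⁻¹' V)) := by
      ext ⟨t, x⟩
      by_cases ht : t = 0
      · simp [ht]
      · have := fun hg : g x ∈ V => hlow (OrderHom.le_def.1 h x) hg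
        simpa [ht] using this
    rw [heq]
    exact (isOpen_univ.prod (hV.preimage g.continuous_of_isLowerSet)).union
      (isOpen_compl_singleton.prod (hV.preimage f.continuous_of_isLowerSet))
  · exact if_pos rfl
  · exact if_neg one_ne_zero

theorem OrderLinked.homotopic {f g : X →o Y} (h : OrderLinked f g) :
    ContinuousMap.Homotopic f.toLowerContinuousMap g.toLowerContinuousMap := by
  induction h with
  | rel _ _ h => exact (homotopic_of_le h).symm
  | refl => exact .refl _
  | symm _ _ _ ih => exact ih.symm
  | trans _ _ _ _ _ ih₁ ih₂ => exact ih₁.trans ih₂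

/-- `Set.Iic (F (t, x))` is open, so `F (s, x) ≤ F (t, x)` for `s` near `t`, uniformly in `x` as `X`
is finite. Local links spread over the connected interval. -/
theorem orderLinked_of_homotopic [Finite X] {f g : X →o Y}
    (h : ContinuousMap.Homotopic f.toLowerContinuousMap g.toLowerContinuousMap) :
    OrderLinked f g := by
  obtain ⟨F⟩ := h
  have key : OrderLinked (F.curry 0).toLowerOrderHom (F.curry 1).toLowerOrderHom := by
    refine PreconnectedSpace.induction₂'
      (fun s t : I => OrderLinked (F.curry s).toLowerOrderHom (F.curry t).toLowerOrderHom)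
      (fun t => ?_) ⟨fun _ _ _ => Relation.EqvGen.trans _ _ _⟩ 0 1
    have hmem : ∀ x, ∀ᶠ s in 𝓝 t, F (s, x) ≤ F (t, x) := fun x => by
      have ho : IsOpen (Set.Iic (F (t, x))) :=
        Topology.IsLowerSet.isOpen_iff_isLowerSet.2 (isLowerSet_Iic _)
      have hc : Continuous fun s : I => F (s, x) := by fun_prop
      exact hc.continuousAt.eventually (ho.mem_nhds (Set.mem_Iic.2 le_rfl))
    filter_upwards [Filter.eventually_all.2 hmem] with s hs
    have hl : OrderLinked (F.curry s).toLowerOrderHom (F.curry t).toLowerOrderHom :=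
      OrderLinked.of_le hs
    exact ⟨.symm _ _ hl, hl⟩
  have h0 : (F.curry 0).toLowerOrderHom = f := by ext x; exact F.apply_zero x
  have h1 : (F.curry 1).toLowerOrderHom = g := by ext x; exact F.apply_one x
  rwa [h0, h1] at key

theorem orderLinked_of_connected [ConnectedSpace X] (x y : X) : OrderLinked x y := by
  refine PreconnectedSpace.induction₂' (fun x y : X => OrderLinked x y)
    (fun x => ?_) ⟨fun _ _ _ => Relation.EqvGen.trans _ _ _⟩ x y
  have ho : IsOpen (Set.Iic x) := Topology.IsLowerSet.isOpen_iff_isLowerSet.2 (isLowerSet_Iic _)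
  filter_upwards [ho.mem_nhds (Set.mem_Iic.2 le_rfl)] with y hy
  have hl : OrderLinked y x := OrderLinked.of_le hy
  exact ⟨.symm _ _ hl, hl⟩

/-- The inclusion of a subset as a monotone map. -/
def inclusionHom (U : Set X) : U →o X := ⟨Subtype.val, fun _ _ h => h⟩

/-- By currying, a section is a homotopy from the constant map to the inclusion. -/
theorem exists_path_section_iff [Finite X] {U : Set X} {x₀ : X} :
    (∃ s : C(U, BasedPathSpace X x₀), ∀ b : U, (s b).1 1 = b) ↔
      OrderLinked (OrderHom.const U x₀) (inclusionHom U) := by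
  constructor
  · rintro ⟨s, hs⟩
    have hc : Continuous fun p : U × I => (s p.1).1 p.2 :=
      ContinuousMap.continuous_uncurry_of_continuous
        ⟨fun u => (s u).1, continuous_subtype_val.comp s.continuous⟩
    exact orderLinked_of_homotopic
      ⟨⟨⟨fun p : I × U => (s p.2).1 p.1, hc.comp continuous_swap⟩, fun x => (s x).2, hs⟩⟩
  · intro h
    obtain ⟨F⟩ := h.homotopic
    let G : C(U, C(I, X)) := ContinuousMap.curry ⟨fun p : U × I => F (p.2, p.1), by fun_prop⟩
    exact ⟨⟨fun u => ⟨G u, F.apply_zero u⟩, G.continuous.subtype_mk _⟩, fun u => F.apply_one u⟩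

/-- `X` is covered by `r` open sets whose inclusions are linked to the constant map at `x₀`. -/
def HasCategoricalCover (x₀ : X) (r : ℕ) : Prop :=
  ∃ U : Fin r → Set X, (∀ i, IsOpen (U i)) ∧ (⋃ i, U i) = Set.univ ∧
    ∀ i, OrderLinked (OrderHom.const (U i) x₀) (inclusionHom (U i))

theorem lsCat_le [Finite X] {x₀ : X} {r : ℕ} (h : HasCategoricalCover x₀ r) : lsCat X x₀ ≤ r := by
  obtain ⟨U, hUo, hU, hs⟩ := h
  exact iInf₂_le r ⟨U, hUo, hU, fun i => exists_path_section_iff.2 (hs i)⟩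

theorem le_lsCat [Finite X] {x₀ : X} {c : ℕ∞} (h : ∀ r : ℕ, HasCategoricalCover x₀ r → c ≤ r) :
    c ≤ lsCat X x₀ :=
  le_iInf₂ fun r ⟨U, hUo, hU, hs⟩ => h r ⟨U, hUo, hU, fun i => exists_path_section_iff.1 (hs i)⟩

/-- A finite infimum in `ℕ∞` is attained. -/
theorem exists_categoricalCover [Finite X] {x₀ : X} (h : lsCat X x₀ ≠ ⊤) :
    ∃ r : ℕ, HasCategoricalCover x₀ r ∧ (r : ℕ∞) ≤ lsCat X x₀ := by
  by_contra hn
  push Not at hn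
  have : lsCat X x₀ + 1 ≤ lsCat X x₀ :=
    le_lsCat fun r hr => Order.add_one_le_of_lt (hn r hr)
  exact absurd (ENat.lt_add_one_iff h |>.2 le_rfl) this.not_gt

end Topology

/-! ### The invariance and comparison theorems -/

section Main

variable {P : Type*} [PartialOrder P]

/-- The embedding of `P` into `P^k` as the line through `x` in direction `j`. -/
def lineHom {k : ℕ} (j : Fin k) (x : P) : P →o (Fin k → P) where
  toFun y := Function.update (fun _ => x) j y
  monotone' _ _ h := update_le_update_iff.2 ⟨h, fun _ _ => le_rfl⟩

theorem lineHom_self {k : ℕ} (j : Fin k) (x y : P) : lineHom j x y j = y := by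
  change Function.update (fun _ : Fin k => x) j y j = y
  simp

theorem lineHom_of_ne {k : ℕ} {i j : Fin k} (h : j ≠ i) (x y : P) : lineHom i x y j = x := by
  change Function.update (fun _ : Fin k => x) i y j = x
  simp [h]

variable [TopologicalSpace P]

theorem fenceContractible_iff [Nonempty P] {n : ℕ} (hn : 2 ≤ n) :
    FenceContractible P ↔ higherCombComplexity n P = 1 := by
  rw [higherCombComplexity_eq_one_iff]
  constructor
  · rintro ⟨x₀, h⟩
    rw [fenceHomotopic_iff_orderLinked] at h
    exact ⟨fun _ => Set.univ, fun _ => isOpen_univ, Set.iUnion_const _, fun _ =>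
      ⟨OrderHom.const _ x₀, fun j => .symm _ _ (h.comp_right (coordHom _ j))⟩⟩
  · rintro ⟨U, -, hU, hg⟩
    have hU0 : U 0 = Set.univ := by
      rw [← hU]
      exact (Set.iUnion_eq_const fun i => by rw [Subsingleton.elim i 0]).symm
    obtain ⟨g, hg⟩ := hg 0
    obtain ⟨x⟩ := ‹Nonempty P›
    let i : Fin n := ⟨0, by omega⟩
    let j : Fin n := ⟨1, by omega⟩
    have hij : j ≠ i := by simp [i, j]
    -- Along this line the `i`-th projection is the identity and the `j`-th is constant.
    let ψ : P →o U 0 := ⟨fun y => ⟨lineHom i x y, hU0 ▸ Set.mem_univ _⟩,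
      fun _ _ h => (lineHom i x).monotone h⟩
    refine ⟨x, fenceHomotopic_iff_orderLinked.2 ?_⟩
    have h := (OrderLinked.trans (.symm _ _ (hg i)) (hg j)).comp_right ψ
    have h0 : (coordHom (U 0) i).comp ψ = OrderHom.id := by
      ext y; exact lineHom_self i x y
    have h1 : (coordHom (U 0) j).comp ψ = OrderHom.const P x := by
      ext y; exact lineHom_of_ne hij x y
    rwa [h0, h1] at h

variable [Topology.IsLowerSet P]

theorem higherCombComplexity_le_succ [Nonempty P] (n : ℕ) :
    higherCombComplexity n P ≤ higherCombComplexity (n + 1) P := by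
  refine le_higherCombComplexity fun r _ h => higherCombComplexity_le ?_
  obtain ⟨x⟩ := ‹Nonempty P›
  let φ : (Fin n → P) →o (Fin (n + 1) → P) :=
    ⟨fun y => Fin.cons x y, fun a b hab => Fin.cons_le_cons.2 ⟨le_rfl, hab⟩⟩
  exact h.transport φ φ.continuous_of_isLowerSet OrderHom.id Fin.succ fun j => .refl _

theorem contractibleSpace_iff_fenceContractible [Finite P] :
    ContractibleSpace P ↔ FenceContractible P := by
  rw [contractible_iff_id_nullhomotopic]
  exact exists_congr fun x => by
    rw [fenceHomotopic_iff_orderLinked]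
    exact ⟨orderLinked_of_homotopic (f := OrderHom.id) (g := OrderHom.const P x),
      OrderLinked.homotopic⟩

/-- The complexity does not increase under passage to a homotopy retract. -/
theorem higherCombComplexity_le_of_dominated [Nonempty P] {Q : Type*} [PartialOrder Q]
    [TopologicalSpace Q] [Topology.IsLowerSet Q] (n : ℕ) (f : P →o Q) (g : Q →o P)
    (h : OrderLinked (g.comp f) OrderHom.id) :
    higherCombComplexity n P ≤ higherCombComplexity n Q := by
  refine le_higherCombComplexity fun r _ hr => higherCombComplexity_le ?_
  let φ : (Fin n → P) →o (Fin n → Q) :=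
    ⟨fun y j => f (y j), fun _ _ hab j => f.monotone (hab j)⟩
  exact hr.transport φ φ.continuous_of_isLowerSet g id fun j =>
    h.comp_right (⟨fun y => y j, fun _ _ hxy => hxy j⟩ : (Fin n → P) →o P)

theorem lsCat_le_higherCombComplexity [Finite P] {n : ℕ} (hn : 2 ≤ n) (x₀ : P) :
    lsCat P x₀ ≤ higherCombComplexity n P := by
  refine le_higherCombComplexity fun r _ ⟨U, hUo, hU, hg⟩ => lsCat_le ?_
  let i : Fin n := ⟨0, by omega⟩
  let j : Fin n := ⟨1, by omega⟩
  have hij : j ≠ i := by simp [i, j]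
  refine ⟨fun k => lineHom i x₀ ⁻¹' U k,
    fun k => (hUo k).preimage (lineHom i x₀).continuous_of_isLowerSet,
    by rw [← Set.preimage_iUnion, hU, Set.preimage_univ], fun k => ?_⟩
  obtain ⟨g, hg⟩ := hg k
  let ψ : (lineHom i x₀ ⁻¹' U k : Set P) →o U k :=
    ⟨fun y => ⟨lineHom i x₀ y, y.2⟩, fun _ _ h => (lineHom i x₀).monotone h⟩
  have h := (OrderLinked.trans (.symm _ _ (hg j)) (hg i)).comp_right ψ
  have h0 : (coordHom (U k) i).comp ψ = inclusionHom _ := by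
    ext y; exact lineHom_self i x₀ y.1
  have h1 : (coordHom (U k) j).comp ψ = OrderHom.const _ x₀ := by
    ext y; exact lineHom_of_ne hij x₀ y.1
  rwa [h0, h1] at h

/-- Projecting the contraction of each member links the `j`-th projection to the constant `y₀ j`;
connectedness links these constants to a single one. -/
theorem higherCombComplexity_le_lsCat [Finite P] [ConnectedSpace P] {n : ℕ} (y₀ : Fin n → P) :
    higherCombComplexity n P ≤ lsCat (Fin n → P) y₀ := by
  refine le_lsCat fun r ⟨U, hUo, hU, hs⟩ => higherCombComplexity_le ⟨U, hUo, hU, fun i => ?_⟩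
  obtain ⟨x⟩ : Nonempty P := inferInstance
  refine ⟨OrderHom.const _ x, fun j => .trans
    (OrderLinked.const (orderLinked_of_connected x (y₀ j))) ?_⟩
  exact (hs i).comp_left (⟨fun y => y j, fun _ _ hxy => hxy j⟩ : (Fin n → P) →o P)

/-- Maps into a finite power are linked if their coordinates are. -/
theorem OrderLinked.pi {A B : Type*} [Preorder A] [Preorder B] {ι : Type*} [Finite ι]
    {f g : A →o (ι → B)}
    (h : ∀ j, OrderLinked ((Pi.evalOrderHom j).comp f) ((Pi.evalOrderHom j).comp g)) :
    OrderLinked f g := by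
  have := Fintype.ofFinite ι
  -- All coordinate zigzags share the parity pattern, so they run simultaneously until the last has
  -- stabilised.
  choose h hh h0 M hM using fun j => (h j).exists_zigzag
  let H (k : ℕ) : A →o (ι → B) := OrderHom.pi fun j => h j k
  have hH : IsZigzag H :=
    ⟨fun k hk x j => (hh j).1 k hk x, fun k hk x j => (hh j).2 k hk x⟩
  have hlink : ∀ k, OrderLinked (H 0) (H k) := by
    intro k
    induction k with
    | zero => exact .refl _
    | succ k ih =>
      refine .trans ih ?_
      rcases Nat.even_or_odd k with hk | hk
      · exact OrderLinked.of_le (hH.1 k hk)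
      · exact .symm _ _ (OrderLinked.of_le (hH.2 k hk))
  have hf : H 0 = f := by
    ext x j
    exact congrArg (fun k : A →o B => k x) (h0 j)
  have hg : H (Finset.univ.sup M) = g := by
    ext x j
    exact congrArg (fun k : A →o B => k x) (hM j _ (Finset.le_sup (Finset.mem_univ j)))
  rw [← hf, ← hg]
  exact hlink _

theorem lsCat_pi_le [Finite P] [ConnectedSpace P] {n : ℕ} (hn : n ≠ 0) (x₀ : P)
    (y₀ : Fin n → P) : lsCat (Fin n → P) y₀ ≤ lsCat P x₀ ^ n := by
  by_cases htop : lsCat P x₀ = ⊤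
  · rw [htop, ENat.top_pow hn]
    exact le_top
  obtain ⟨r, ⟨U, hUo, hU, hs⟩, hr⟩ := exists_categoricalCover htop
  refine le_trans ?_ (pow_le_pow_left₀ zero_le hr n)
  suffices h : HasCategoricalCover y₀ (r ^ n) by exact_mod_cast lsCat_le h
  -- Boxes of members of the cover of `P`, one for each of the `r ^ n` choice functions.
  let V (c : Fin n → Fin r) : Set (Fin n → P) := Set.univ.pi fun j => U (c j)
  refine ⟨fun i => V (finFunctionFinEquiv.symm i),
    fun i => isOpen_set_pi Set.finite_univ fun j _ => hUo _, ?_, fun i => ?_⟩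
  · refine Set.eq_univ_of_forall fun y => ?_
    have hy : ∀ j, ∃ i, y j ∈ U i := fun j => Set.mem_iUnion.1 (hU ▸ Set.mem_univ (y j))
    choose c hc using hy
    exact Set.mem_iUnion.2 ⟨finFunctionFinEquiv c, by simpa [V] using hc⟩
  · have key : ∀ c, OrderLinked (OrderHom.const (V c) y₀) (inclusionHom (V c)) := fun c =>
      OrderLinked.pi fun j => by
        let ψ : V c →o U (c j) := ⟨fun y => ⟨y.1 j, y.2 j (Set.mem_univ j)⟩, fun _ _ h => h j⟩
        exact .trans (OrderLinked.const (orderLinked_of_connected (y₀ j) x₀))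
          ((hs (c j)).comp_right ψ)
    exact key _

end Main

theorem mainTheorem6 {P : Type*} [PartialOrder P] [TopologicalSpace P] [Topology.IsLowerSet P]
    [Finite P] [ConnectedSpace P] (n : ℕ) (hn : 2 ≤ n) :
    higherCombComplexity n P ≤ higherCombComplexity (n + 1) P ∧
    ((ContractibleSpace P ↔ higherCombComplexity n P = 1) ∧
      (FenceContractible P ↔ higherCombComplexity n P = 1)) ∧
    (∀ {Q : Type*} [PartialOrder Q] [TopologicalSpace Q] [Topology.IsLowerSet Q]
      [Finite Q] [ConnectedSpace Q],
      (Nonempty (ContinuousMap.HomotopyEquiv P Q) →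
        higherCombComplexity n P = higherCombComplexity n Q) ∧
      (FenceHomotopyEquivalent P Q →
        higherCombComplexity n P = higherCombComplexity n Q)) ∧
    (∀ (x₀ : P) (y₀ : Fin n → P),
      lsCat P x₀ ≤ higherCombComplexity n P ∧
      higherCombComplexity n P ≤ lsCat (Fin n → P) y₀ ∧
      lsCat (Fin n → P) y₀ ≤ lsCat P x₀ ^ n) := by
  refine ⟨higherCombComplexity_le_succ n,
    ⟨contractibleSpace_iff_fenceContractible.trans (fenceContractible_iff hn),
      fenceContractible_iff hn⟩, ?_, fun x₀ y₀ => ⟨lsCat_le_higherCombComplexity hn x₀,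
      higherCombComplexity_le_lsCat y₀, lsCat_pi_le (by omega) x₀ y₀⟩⟩
  intro Q _ _ _ _ _
  constructor
  · rintro ⟨e⟩
    exact le_antisymm
      (higherCombComplexity_le_of_dominated n e.toFun.toLowerOrderHom e.invFun.toLowerOrderHom
        (orderLinked_of_homotopic e.left_inv))
      (higherCombComplexity_le_of_dominated n e.invFun.toLowerOrderHom e.toFun.toLowerOrderHom
        (orderLinked_of_homotopic e.right_inv))
  · rintro ⟨f, g, hgf, hfg⟩
    exact le_antisymm
      (higherCombComplexity_le_of_dominated n f g (fenceHomotopic_iff_orderLinked.1 hgf))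
      (higherCombComplexity_le_of_dominated n g f (fenceHomotopic_iff_orderLinked.1 hfg))
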